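/- Let $d\ge 1$ and let $\Omega\subset\mathbb R^d$ be a bounded open set (for instance a bounded Lipschitz domain, $d\in\{1,2,3\}$). Write $(\cdot,\cdot)$ and $\|\cdot\|$ for the inner products and norms of $L^2(\Omega)$ and $[L^2(\Omega)]^d$, let $V=H^1_0(\Omega)$ (the closure of $C_c^\infty(\Omega)$ in $H^1(\Omega)$) and $H(\mathrm{div},\Omega)=\{\tau\in[L^2(\Omega)]^d:\ \mathrm{div}\,\tau\in L^2(\Omega)\}$. Let $\nu$ be measurable on $\Omega$ with $0<\underline\nu\le\nu\le\overline\nu$ a.e. for constants $\underline\nu,\overline\nu$, let $y_d,u_d,f,u_a,u_b\in L^2(\Omega)$ with $u_a\le u_b$ a.e., let $\lambda>0$, and set $U_{\rm ad}=\{v\in L^2(\Omega): u_a\le v\le u_b \text{ a.e.}\}$. For $v\in L^2(\Omega)$ let $y(v)\in V$ denote the weak solution of $-\mathrm{div}(\nu\nabla y)=f+v$, i.e. $(\nu\nabla y,\nabla w)=(f+v,w)$ for all $w\in V$. The optimal control problem is to minimize $\mathcal J(y(v),v)=\frac12\|y(v)-y_d\|^2+\frac\lambda2\|v-u_d\|^2$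 over $v\in U_{\rm ad}$. Its optimality system for $(y,u,p)\in V\times U_{\rm ad}\times V$ is $$(\nu\nabla y,\nabla w)=(f+u,w)\ \ \forall w\in V,\qquad (\nu\nabla p,\nabla w)=(y-y_d,w)\ \ \forall w\in V,\qquad (p+\lambda(u-u_d),w-u)\ge 0\ \ \forall w\in U_{\rm ad}.$$ A Friedrichs constant is a number $C_F>0$ with $\|w\|\le C_F\|\nabla w\|$ for all $w\in V$. For $\zeta\in V$ put $v_\zeta=\min\{u_b,\max\{u_a,u_d-\frac1\lambda\zeta\}\}$ a.e. For a Friedrichs constant $C_F$, $\alpha,\beta>0$, $\eta,\zeta\in V$, $\tau,\rho\in H(\mathrm{div},\Omega)$ and $v\in U_{\rm ad}$ define $$\mathcal M^\oplus(\alpha,\beta;\eta,\zeta,\tau,\rho,v)=\mathcal J^\oplus(\alpha,\beta;\eta,\tau,v)-\mathcal J^\ominus(\eta,\zeta,\tau,\rho,v),$$ where $$\mathcal J^\oplus=\tfrac{1+\alpha}2\|\eta-y_d\|^2+\tfrac{(1+\alpha)(1+\beta)C_F^2}{2\alpha\underline\nu^2}\|\tau-\nu\nabla\eta\|^2+\tfrac{(1+\alpha)(1+\beta)C_F^4}{2\alpha\beta\underline\nu^2}\|f+v+\mathrm{div}\,\tau\|^2+\tfrac\lambda2\|v-u_d\|^2$$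 and $$\begin{aligned}\mathcal J^\ominus={}&\tfrac12\|\eta-y_d\|^2+\tfrac\lambda2\|v-u_d\|^2+(f+v+\mathrm{div}\,\tau,\zeta)+(\tau-\nu\nabla\eta,\nabla\zeta)\\&-\tfrac1{\underline\nu}\big(C_F\|\eta-y_d+\mathrm{div}\,\rho\|+\|\rho-\nu\nabla\zeta\|\big)\\&\quad\times\Big(\tfrac{C_F^3}{\lambda\underline\nu}\|\eta-y_d+\mathrm{div}\,\rho\|+\tfrac{C_F^2}{\lambda\underline\nu}\|\rho-\nu\nabla\zeta\|+C_F\|f+v+\mathrm{div}\,\tau\|+\|\tau-\nu\nabla\eta\|\Big).\end{aligned}$$ Then a Friedrichs constant exists; the optimality system has exactly one solution $(y,u,p)$; and a pair $(y,u)$ solves the optimal control problem (that is, $u\in U_{\rm ad}$ is optimal and $y=y(u)$) if and only if $(y,u,p)$ solves the optimality system for some $p$. Moreover, for every Friedrichs constant $C_F$, $$\inf_{\eta,\zeta\in V,\ \tau,\rho\in H(\mathrm{div},\Omega),\ \alpha,\beta>0}\mathcal M^\oplus(\alpha,\beta;\eta,\zeta,\tau,\rho,v_\zeta)=0,$$ and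 this infimum is approached at the exact solution: if $(y,u,p)$ solves the optimality system, then $v_p=u$, the fluxes $\nu\nabla y$ and $\nu\nabla p$ lie in $H(\mathrm{div},\Omega)$, for all $\alpha,\beta>0$ $$\mathcal M^\oplus(\alpha,\beta;y,p,\nu\nabla y,\nu\nabla p,u)=\tfrac\alpha2\|y-y_d\|^2,$$ and for every fixed $\beta>0$ this tends to $0$ as $\alpha\to0^+$. -/

import Mathlib

open MeasureTheory Filter Topology
open scoped ContDiff ENNReal

noncomputable section

namespace EllipticOCP

/-- Euclidean space `ℝ^d`. -/
abbrev Space (d : ℕ) : Type := EuclideanSpace ℝ (Fin d)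

/-- `L²(Ω)`. Its order `≤`, `⊓`, `⊔` is the pointwise almost everywhere one. -/
abbrev L2 {d : ℕ} (Ω : Set (Space d)) : Type := Lp ℝ 2 (volume.restrict Ω)

/-- `[L²(Ω)]^d`, with the Euclidean norm on the values. -/
abbrev L2Vec {d : ℕ} (Ω : Set (Space d)) : Type := Lp (Space d) 2 (volume.restrict Ω)

variable {d : ℕ} {Ω : Set (Space d)}

/-- `φ ∈ C_c^∞(Ω)`. -/
def IsTestFunction (Ω : Set (Space d)) (φ : Space d → ℝ) : Prop :=
  ContDiff ℝ ∞ φ ∧ HasCompactSupport φ ∧ tsupport φ ⊆ Ω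

/-- `G` is the weak gradient of `w` in `Ω`. -/
def IsWeakGradient (w : L2 Ω) (G : L2Vec Ω) : Prop :=
  ∀ φ : Space d → ℝ, IsTestFunction Ω φ →
    ∫ x in Ω, w x • gradient φ x = - ∫ x in Ω, φ x • G x

/-- `g` is the weak divergence of `τ` in `Ω`. -/
def IsWeakDivergence (τ : L2Vec Ω) (g : L2 Ω) : Prop :=
  ∀ φ : Space d → ℝ, IsTestFunction Ω φ →
    ∫ x in Ω, inner ℝ (τ x) (gradient φ x) = - ∫ x in Ω, g x * φ x

open Classical in
/-- The weak gradient `∇w` (zero if `w` has none in `L²`; it is only used for `w ∈ H¹₀(Ω)`). -/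
def grad (w : L2 Ω) : L2Vec Ω :=
  if h : ∃ G : L2Vec Ω, IsWeakGradient w G then h.choose else 0

open Classical in
/-- The weak divergence `div τ` (zero if `τ` has none in `L²`; it is only used for
`τ ∈ H(div, Ω)`). -/
def divergence (τ : L2Vec Ω) : L2 Ω :=
  if h : ∃ g : L2 Ω, IsWeakDivergence τ g then h.choose else 0

/-- `V = H¹₀(Ω)`: the `w ∈ L²(Ω)` with a weak gradient in `L²` that are limits of test functions
in the norm of `H¹(Ω)`. -/
def H10 (Ω : Set (Space d)) : Set (L2 Ω) :=
  {w | (∃ G : L2Vec Ω, IsWeakGradient w G) ∧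
    ∀ ε : ℝ≥0∞, 0 < ε → ∃ φ : Space d → ℝ, IsTestFunction Ω φ ∧
      eLpNorm (fun x => w x - φ x) 2 (volume.restrict Ω) < ε ∧
      eLpNorm (fun x => grad w x - gradient φ x) 2 (volume.restrict Ω) < ε}

/-- `H(div, Ω)`. -/
def Hdiv (Ω : Set (Space d)) : Set (L2Vec Ω) :=
  {τ | ∃ g : L2 Ω, IsWeakDivergence τ g}

/-- `C` is a constant for the Friedrichs inequality `‖w‖ ≤ C ‖∇w‖` on `H¹₀(Ω)`. -/
def IsFriedrichsConstant (Ω : Set (Space d)) (C : ℝ) : Prop :=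
  0 < C ∧ ∀ w ∈ H10 Ω, ‖w‖ ≤ C * ‖grad w‖

/-- The data of the control problem in `Ω`, with the standing assumptions on them. -/
structure Problem (Ω : Set (Space d)) where
  /-- the diffusion coefficient -/
  ν : Space d → ℝ
  /-- its lower bound -/
  νlow : ℝ
  /-- its upper bound -/
  νup : ℝ
  ν_meas : AEMeasurable ν (volume.restrict Ω)
  νlow_pos : 0 < νlow
  ν_bounds : ∀ᵐ x ∂(volume.restrict Ω), νlow ≤ ν x ∧ ν x ≤ νup
  /-- the desired state -/
  yd : L2 Ω
  /-- the desired control -/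
  ud : L2 Ω
  /-- the right-hand side -/
  f : L2 Ω
  /-- the lower bound for the control -/
  ua : L2 Ω
  /-- the upper bound for the control -/
  ub : L2 Ω
  ua_le_ub : ua ≤ ub
  /-- the regularization parameter -/
  lam : ℝ
  lam_pos : 0 < lam

namespace Problem

variable (P : Problem Ω)

theorem memLp_flux (G : L2Vec Ω) :
    MemLp (fun x => P.ν x • G x) 2 (volume.restrict Ω) := by
  refine (Lp.memLp G).of_le_mul (c := P.νup)
    (P.ν_meas.aestronglyMeasurable.smul (Lp.aestronglyMeasurable G)) ?_
  filter_upwards [P.ν_bounds] with x hx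
  have h0 : 0 ≤ P.ν x := P.νlow_pos.le.trans hx.1
  rw [norm_smul, Real.norm_of_nonneg h0]
  exact mul_le_mul_of_nonneg_right hx.2 (norm_nonneg _)

/-- The vector field `ν G`. -/
def coeffMul (G : L2Vec Ω) : L2Vec Ω := (P.memLp_flux G).toLp (fun x => P.ν x • G x)

/-- The exact flux `ν ∇w`. -/
def flux (w : L2 Ω) : L2Vec Ω := P.coeffMul (grad w)

/-- The admissible controls: `ua ≤ v ≤ ub` almost everywhere in `Ω`. -/
def Uad : Set (L2 Ω) := {v | P.ua ≤ v ∧ v ≤ P.ub}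

/-- `y` is the weak solution of `- div (ν ∇y) = f + v` in `Ω`, `y = 0` on the boundary. -/
def IsState (v y : L2 Ω) : Prop :=
  y ∈ H10 Ω ∧ ∀ w ∈ H10 Ω, inner ℝ (P.flux y) (grad w) = inner ℝ (P.f + v) w

/-- The cost functional. -/
def J (y v : L2 Ω) : ℝ := 1 / 2 * ‖y - P.yd‖ ^ 2 + P.lam / 2 * ‖v - P.ud‖ ^ 2

/-- `u`, with its state `y`, solves the optimal control problem. -/
def IsOptimal (y u : L2 Ω) : Prop :=
  u ∈ P.Uad ∧ P.IsState u y ∧ ∀ v ∈ P.Uad, ∀ z : L2 Ω, P.IsState v z → P.J y u ≤ P.J z v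

/-- `(y, u, p) ∈ V × Uad × V` solves the optimality system: the state equation, the adjoint
equation and the variational inequality. -/
def SolvesOptimalitySystem (y u p : L2 Ω) : Prop :=
  P.IsState u y ∧
  (p ∈ H10 Ω ∧ ∀ w ∈ H10 Ω, inner ℝ (P.flux p) (grad w) = inner ℝ (y - P.yd) w) ∧
  (u ∈ P.Uad ∧ ∀ w ∈ P.Uad, 0 ≤ inner ℝ (p + P.lam • (u - P.ud)) (w - u))

/-- The control `v_ζ`, i.e. `min {ub, max {ua, ud - ζ / lam}}` almost everywhere. -/
def control (ζ : L2 Ω) : L2 Ω := P.ub ⊓ (P.ua ⊔ (P.ud - (1 / P.lam) • ζ))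

/-- The majorant of the cost functional, with the Friedrichs constant `C`. -/
def costMajorant (C α β : ℝ) (η : L2 Ω) (τ : L2Vec Ω) (v : L2 Ω) : ℝ :=
  (1 + α) / 2 * ‖η - P.yd‖ ^ 2
    + (1 + α) * (1 + β) * C ^ 2 / (2 * α * P.νlow ^ 2) * ‖τ - P.flux η‖ ^ 2
    + (1 + α) * (1 + β) * C ^ 4 / (2 * α * β * P.νlow ^ 2) * ‖P.f + v + divergence τ‖ ^ 2
    + P.lam / 2 * ‖v - P.ud‖ ^ 2

/-- The minorant of the cost functional, with the Friedrichs constant `C`. -/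
def costMinorant (C : ℝ) (η ζ : L2 Ω) (τ ρ : L2Vec Ω) (v : L2 Ω) : ℝ :=
  1 / 2 * ‖η - P.yd‖ ^ 2 + P.lam / 2 * ‖v - P.ud‖ ^ 2
    + inner ℝ (P.f + v + divergence τ) ζ
    + inner ℝ (τ - P.flux η) (grad ζ)
    - 1 / P.νlow * (C * ‖η - P.yd + divergence ρ‖ + ‖ρ - P.flux ζ‖)
      * (C ^ 3 / (P.lam * P.νlow) * ‖η - P.yd + divergence ρ‖
        + C ^ 2 / (P.lam * P.νlow) * ‖ρ - P.flux ζ‖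
        + C * ‖P.f + v + divergence τ‖
        + ‖τ - P.flux η‖)

/-- The error majorant `M⊕(α, β; η, ζ, τ, ρ, v)`. -/
def errorMajorant (C α β : ℝ) (η ζ : L2 Ω) (τ ρ : L2Vec Ω) (v : L2 Ω) : ℝ :=
  P.costMajorant C α β η τ v - P.costMinorant C η ζ τ ρ v

end Problem

end EllipticOCP

end

/-! The closure of the pairs `(φ, ∇φ)` in `L² × [L²]^d` is the graph of the gradient on `H¹₀(Ω)`, so
it is a Hilbert space on which identities and inequalities extend from test functions by density.
The Friedrichs inequality makes `(ν∇·, ∇·)` coercive there, and Lax–Milgram gives a linear solution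
operator `S`, self-adjoint because `ν` is a scalar. The control problem is thus a projection onto a
convex set, whose variational inequality is the optimality system with `p = S(y - yd)`. Quadratic
growth of the cost (`SolvesOptimalitySystem.J_add_le`) gives uniqueness and the equivalence.

For any control `v`, the true cost `J(y(v), v)` lies between the minorant and the majorant
(`costMinorant_le_J`, `J_le_costMajorant`), hence the error majorant is nonnegative. At the exact
solution all residuals vanish and only `α/2 ‖y - yd‖²` is left, which is arbitrarily small. -/

noncomputable section

namespace EllipticOCP

variable {d : ℕ} {Ω : Set (Space d)}

/-! ### Test functions and their gradients as `L²` elements -/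

namespace IsTestFunction

variable {φ ψ : Space d → ℝ}

theorem zero : IsTestFunction Ω (0 : Space d → ℝ) :=
  ⟨contDiff_zero_fun, HasCompactSupport.zero, by simp [tsupport]⟩

theorem add (hφ : IsTestFunction Ω φ) (hψ : IsTestFunction Ω ψ) :
    IsTestFunction Ω (φ + ψ) :=
  ⟨hφ.1.add hψ.1, hφ.2.1.add hψ.2.1,
    (tsupport_add φ ψ).trans (Set.union_subset hφ.2.2 hψ.2.2)⟩

theorem smul (c : ℝ) (hφ : IsTestFunction Ω φ) : IsTestFunction Ω (c • φ) :=
  ⟨contDiff_const.smul hφ.1, hφ.2.1.smul_left (f := fun _ => c),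
    (tsupport_smul_subset_right (fun _ => c) φ).trans hφ.2.2⟩

theorem differentiable (hφ : IsTestFunction Ω φ) : Differentiable ℝ φ :=
  hφ.1.differentiable (by simp)

theorem continuous (hφ : IsTestFunction Ω φ) : Continuous φ := hφ.1.continuous

theorem continuous_gradient (hφ : IsTestFunction Ω φ) : Continuous (gradient φ) :=
  (InnerProductSpace.toDual ℝ (Space d)).symm.continuous.comp
    (hφ.1.continuous_fderiv (by simp))

theorem hasCompactSupport_gradient (hφ : IsTestFunction Ω φ) :
    HasCompactSupport (gradient φ) :=
  (hφ.2.1.fderiv ℝ).comp_left (g := (InnerProductSpace.toDual ℝ (Space d)).symm) (map_zero _)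

theorem eq_zero (hφ : IsTestFunction Ω φ) {x : Space d} (hx : x ∉ Ω) : φ x = 0 :=
  image_eq_zero_of_notMem_tsupport fun h => hx (hφ.2.2 h)

theorem memLp (hφ : IsTestFunction Ω φ) : MemLp φ 2 (volume.restrict Ω) :=
  hφ.continuous.memLp_of_hasCompactSupport hφ.2.1

theorem memLp_gradient (hφ : IsTestFunction Ω φ) :
    MemLp (gradient φ) 2 (volume.restrict Ω) :=
  hφ.continuous_gradient.memLp_of_hasCompactSupport hφ.hasCompactSupport_gradient

/-- A test function as an element of `L²(Ω)`. -/
def toL2 (hφ : IsTestFunction Ω φ) : L2 Ω := hφ.memLp.toLp φ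

/-- The classical gradient of a test function as an element of `[L²(Ω)]^d`. -/
def gradL2 (hφ : IsTestFunction Ω φ) : L2Vec Ω := hφ.memLp_gradient.toLp (gradient φ)

theorem coeFn_toL2 (hφ : IsTestFunction Ω φ) : hφ.toL2 =ᵐ[volume.restrict Ω] φ :=
  MemLp.coeFn_toLp _

theorem coeFn_gradL2 (hφ : IsTestFunction Ω φ) :
    hφ.gradL2 =ᵐ[volume.restrict Ω] gradient φ :=
  MemLp.coeFn_toLp _

theorem memLp_inner_gradient (hφ : IsTestFunction Ω φ) (e : Space d) :
    MemLp (fun x => inner ℝ e (gradient φ x)) 2 (volume.restrict Ω) :=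
  hφ.memLp_gradient.const_inner e

theorem memLp_smul_const (hφ : IsTestFunction Ω φ) (e : Space d) :
    MemLp (fun x => φ x • e) 2 (volume.restrict Ω) :=
  (hφ.continuous.smul continuous_const).memLp_of_hasCompactSupport
    (hφ.2.1.smul_right (f' := fun _ => e))

end IsTestFunction

/-! ### Weak gradient and weak divergence: linear form and uniqueness -/

theorem gradient_add {φ ψ : Space d → ℝ} (hφ : Differentiable ℝ φ) (hψ : Differentiable ℝ ψ) :
    gradient (φ + ψ) = gradient φ + gradient ψ := by
  funext x
  simp [gradient, fderiv_add (hφ x) (hψ x)]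

theorem gradient_const_smul {φ : Space d → ℝ} (c : ℝ) (hφ : Differentiable ℝ φ) :
    gradient (c • φ) = c • gradient φ := by
  funext x
  simp [gradient, fderiv_const_smul (hφ x)]

/-- The weak gradient tested against test functions times constant vectors. -/
theorem isWeakGradient_iff {w : L2 Ω} {G : L2Vec Ω} :
    IsWeakGradient w G ↔ ∀ (φ : Space d → ℝ) (hφ : IsTestFunction Ω φ) (e : Space d),
      inner ℝ w ((hφ.memLp_inner_gradient e).toLp _)
        + inner ℝ G ((hφ.memLp_smul_const e).toLp _) = 0 := by
  refine forall_congr' fun φ => forall_congr' fun hφ => ?_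
  have i1 : Integrable (fun x => w x • gradient φ x) (volume.restrict Ω) :=
    memLp_one_iff_integrable.1 (hφ.memLp_gradient.smul (r := 1) (Lp.memLp w))
  have i2 : Integrable (fun x => φ x • G x) (volume.restrict Ω) :=
    memLp_one_iff_integrable.1 ((Lp.memLp G).smul (r := 1) hφ.memLp)
  have e1 : ∀ e : Space d, inner ℝ w ((hφ.memLp_inner_gradient e).toLp _)
      = inner ℝ e (∫ x in Ω, w x • gradient φ x) := fun e => by
    rw [L2.inner_def, ← integral_inner i1]
    refine integral_congr_ae ?_
    filter_upwards [(hφ.memLp_inner_gradient e).coeFn_toLp] with x hx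
    rw [hx, inner_smul_right]
    simp [mul_comm]
  have e2 : ∀ e : Space d, inner ℝ G ((hφ.memLp_smul_const e).toLp _)
      = inner ℝ e (∫ x in Ω, φ x • G x) := fun e => by
    rw [L2.inner_def, ← integral_inner i2]
    refine integral_congr_ae ?_
    filter_upwards [(hφ.memLp_smul_const e).coeFn_toLp] with x hx
    rw [hx, inner_smul_right, inner_smul_right, real_inner_comm]
  simp_rw [e1, e2, ← inner_add_right, eq_neg_iff_add_eq_zero]
  exact ⟨fun h e => by rw [h, inner_zero_right], fun h => inner_self_eq_zero.1 (h _)⟩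

theorem eq_zero_of_integral_test_smul {E : Type*} [NormedAddCommGroup E] [NormedSpace ℝ E]
    [CompleteSpace E] (hΩ : IsOpen Ω) (F : Lp E 2 (volume.restrict Ω))
    (h : ∀ φ : Space d → ℝ, IsTestFunction Ω φ → ∫ x in Ω, φ x • F x = 0) : F = 0 := by
  have hloc : LocallyIntegrableOn F Ω volume :=
    locallyIntegrableOn_of_locallyIntegrable_restrict
      ((Lp.memLp F).locallyIntegrable (by norm_num))
  have h0 := hΩ.ae_eq_zero_of_integral_contDiff_smul_eq_zero hloc fun g h1 h2 h3 => by
    have hg : IsTestFunction Ω g := ⟨h1, h2, h3⟩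
    -- Test functions vanish off `Ω`, so the whole-space integral of the fundamental lemma is the
    -- integral over `Ω`.
    rw [← setIntegral_eq_integral_of_forall_compl_eq_zero (s := Ω)]
    · exact h g hg
    · intro x hx
      rw [hg.eq_zero hx, zero_smul]
  rw [Lp.eq_zero_iff_ae_eq_zero]
  exact (ae_restrict_iff' hΩ.measurableSet).2 h0

theorem integrable_test_smul {E : Type*} [NormedAddCommGroup E] [NormedSpace ℝ E]
    {φ : Space d → ℝ} (hφ : IsTestFunction Ω φ) (F : Lp E 2 (volume.restrict Ω)) :
    Integrable (fun x => φ x • F x) (volume.restrict Ω) :=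
  memLp_one_iff_integrable.1 ((Lp.memLp F).smul (r := 1) hφ.memLp)

theorem eq_of_integral_test_smul {E : Type*} [NormedAddCommGroup E] [NormedSpace ℝ E]
    [CompleteSpace E] (hΩ : IsOpen Ω) (F F' : Lp E 2 (volume.restrict Ω))
    (h : ∀ φ : Space d → ℝ, IsTestFunction Ω φ →
      ∫ x in Ω, φ x • F x = ∫ x in Ω, φ x • F' x) : F = F' := by
  rw [← sub_eq_zero]
  refine eq_zero_of_integral_test_smul hΩ _ fun φ hφ => ?_
  rw [← sub_eq_zero.2 (h φ hφ),
    ← integral_sub (integrable_test_smul hφ F) (integrable_test_smul hφ F')]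
  refine integral_congr_ae ?_
  filter_upwards [Lp.coeFn_sub F F'] with x hx
  rw [hx, Pi.sub_apply, smul_sub]

theorem IsWeakGradient.unique (hΩ : IsOpen Ω) {w : L2 Ω} {G G' : L2Vec Ω}
    (h : IsWeakGradient w G) (h' : IsWeakGradient w G') : G = G' :=
  eq_of_integral_test_smul hΩ _ _ fun φ hφ => by
    rw [← neg_inj, ← h φ hφ, ← h' φ hφ]

theorem IsWeakDivergence.unique (hΩ : IsOpen Ω) {τ : L2Vec Ω} {g g' : L2 Ω}
    (h : IsWeakDivergence τ g) (h' : IsWeakDivergence τ g') : g = g' :=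
  eq_of_integral_test_smul hΩ _ _ fun φ hφ => by
    simp_rw [smul_eq_mul, mul_comm (φ _)]
    rw [← neg_inj, ← h φ hφ, ← h' φ hφ]

theorem IsWeakGradient.grad_eq (hΩ : IsOpen Ω) {w : L2 Ω} {G : L2Vec Ω}
    (h : IsWeakGradient w G) : grad w = G := by
  have hex : ∃ G : L2Vec Ω, IsWeakGradient w G := ⟨G, h⟩
  rw [grad, dif_pos hex]
  exact hex.choose_spec.unique hΩ h

theorem IsWeakDivergence.divergence_eq (hΩ : IsOpen Ω) {τ : L2Vec Ω} {g : L2 Ω}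
    (h : IsWeakDivergence τ g) : divergence τ = g := by
  have hex : ∃ g : L2 Ω, IsWeakDivergence τ g := ⟨g, h⟩
  rw [divergence, dif_pos hex]
  exact hex.choose_spec.unique hΩ h

theorem isWeakDivergence_iff {τ : L2Vec Ω} {g : L2 Ω} :
    IsWeakDivergence τ g ↔ ∀ (φ : Space d → ℝ) (hφ : IsTestFunction Ω φ),
      inner ℝ τ hφ.gradL2 + inner ℝ g hφ.toL2 = 0 := by
  refine forall_congr' fun φ => forall_congr' fun hφ => ?_
  rw [eq_neg_iff_add_eq_zero, L2.inner_def, L2.inner_def]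
  have e1 : ∫ x in Ω, inner ℝ (τ x) (gradient φ x) = ∫ x in Ω, inner ℝ (τ x) (hφ.gradL2 x) :=
    integral_congr_ae (by filter_upwards [hφ.coeFn_gradL2] with x hx; rw [hx])
  have e2 : ∫ x in Ω, g x * φ x = ∫ x in Ω, inner ℝ (g x) (hφ.toL2 x) :=
    integral_congr_ae (by filter_upwards [hφ.coeFn_toL2] with x hx; rw [hx]; simp [mul_comm])
  rw [e1, e2]

/-! ### Integration by parts for test functions -/

theorem IsTestFunction.isWeakGradient {φ : Space d → ℝ} (hφ : IsTestFunction Ω φ) :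
    IsWeakGradient hφ.toL2 hφ.gradL2 := by
  intro ψ hψ
  have e1 : ∫ x in Ω, hφ.toL2 x • gradient ψ x = ∫ x, φ x • gradient ψ x := by
    rw [← setIntegral_eq_integral_of_forall_compl_eq_zero (s := Ω)
      (f := fun x => φ x • gradient ψ x)]
    · refine integral_congr_ae ?_
      filter_upwards [hφ.coeFn_toL2] with x hx
      rw [hx]
    · intro x hx
      rw [hφ.eq_zero hx, zero_smul]
  have e2 : ∫ x in Ω, ψ x • hφ.gradL2 x = ∫ x, ψ x • gradient φ x := by
    rw [← setIntegral_eq_integral_of_forall_compl_eq_zero (s := Ω)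
      (f := fun x => ψ x • gradient φ x)]
    · refine integral_congr_ae ?_
      filter_upwards [hφ.coeFn_gradL2] with x hx
      rw [hx]
    · intro x hx
      rw [hψ.eq_zero hx, zero_smul]
  have i1 : Integrable fun x => φ x • gradient ψ x :=
    (hφ.continuous.smul hψ.continuous_gradient).integrable_of_hasCompactSupport hφ.2.1.smul_right
  have i2 : Integrable fun x => ψ x • gradient φ x :=
    (hψ.continuous.smul hφ.continuous_gradient).integrable_of_hasCompactSupport hψ.2.1.smul_right
  rw [e1, e2]
  -- Pairing with a constant vector `e` reduces the vector identity to scalar integration by parts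
  -- along `e`.
  refine ext_inner_left ℝ fun e => ?_
  rw [inner_neg_right, ← integral_inner i1, ← integral_inner i2]
  have key := integral_mul_fderiv_eq_neg_fderiv_mul_of_integrable (μ := volume)
    (f := φ) (g := ψ) (v := e)
    ((i2.const_inner e).congr (.of_forall fun x => by
      simp [inner_smul_right, inner_gradient_right, mul_comm]))
    ((i1.const_inner e).congr (.of_forall fun x => by
      simp [inner_smul_right, inner_gradient_right]))
    ((hφ.continuous.mul hψ.continuous).integrable_of_hasCompactSupport hφ.2.1.mul_right)
    (fun x _ => hφ.differentiable x) (fun x _ => hψ.differentiable x)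
  simpa [inner_smul_right, inner_gradient_right, mul_comm] using key

/-- The Friedrichs inequality for test functions. -/
theorem IsTestFunction.norm_toL2_le (hΩ : IsOpen Ω) {φ : Space d → ℝ} (hφ : IsTestFunction Ω φ)
    {R : ℝ} (hR0 : 0 ≤ R) (hR : ∀ x ∈ Ω, ‖x‖ ≤ R) {e : Space d} (he : ‖e‖ = 1) :
    ‖hφ.toL2‖ ≤ 2 * R * ‖hφ.gradL2‖ := by
  have hcs : HasCompactSupport fun x => (inner ℝ e x * φ x) • e :=
    (hφ.2.1.mul_left (f := fun x => inner ℝ e x)).smul_right (f' := fun _ => e)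
  have hcont : Continuous fun x => (inner ℝ e x * φ x) • e :=
    ((continuous_const.inner continuous_id).mul hφ.continuous).smul continuous_const
  have hmem : MemLp (fun x => (inner ℝ e x * φ x) • e) 2 (volume.restrict Ω) :=
    hcont.memLp_of_hasCompactSupport hcs
  -- `H = (e·x) φ e` is chosen so that `(H, ∇φ) = ∫ (e·x) φ ∂ₑφ`; boundedness of `Ω` gives `‖H‖ ≤ R
  -- ‖φ‖`.
  set H : L2Vec Ω := hmem.toLp _ with hH
  have hHle : ‖H‖ ≤ R * ‖hφ.toL2‖ := by
    refine Lp.norm_le_mul_norm_of_ae_le_mul ?_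
    filter_upwards [hmem.coeFn_toLp, hφ.coeFn_toL2, ae_restrict_mem hΩ.measurableSet]
      with x h1 h2 h3
    rw [hH, h1, h2, norm_smul, norm_mul, he, mul_one]
    refine mul_le_mul_of_nonneg_right ?_ (norm_nonneg _)
    calc ‖inner ℝ e x‖ ≤ ‖e‖ * ‖x‖ := norm_inner_le_norm e x
      _ ≤ R := by rw [he, one_mul]; exact hR x h3
  have hd : ∀ x, fderiv ℝ (fun x => φ x * φ x) x e = 2 * (φ x * inner ℝ e (gradient φ x)) := by
    intro x
    rw [fderiv_fun_mul (hφ.differentiable x) (hφ.differentiable x)]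
    simp [inner_gradient_right]
    ring
  have hf : ∀ x, fderiv ℝ (fun x : Space d => inner ℝ e x) x e = 1 := by
    intro x
    have : fderiv ℝ (fun x : Space d => inner ℝ e x) x = innerSL ℝ e :=
      (innerSL ℝ e).hasFDerivAt.fderiv
    rw [this]
    simp [he]
  have csφ : HasCompactSupport fun x => φ x * φ x := hφ.2.1.mul_right
  -- Since `∂ₑ(e·x) = 1`, integrating `φ²` by parts gives `∫ φ² = -2 ∫ (e·x) φ ∂ₑφ`.
  have key := integral_mul_fderiv_eq_neg_fderiv_mul_of_integrable (μ := volume)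
    (f := fun x : Space d => inner ℝ e x) (g := fun x => φ x * φ x) (v := e)
    (by
      simp_rw [hf, one_mul]
      exact (hφ.continuous.mul hφ.continuous).integrable_of_hasCompactSupport csφ)
    (by
      simp_rw [hd]
      refine Continuous.integrable_of_hasCompactSupport ?_ ?_
      · exact (continuous_const.inner continuous_id).mul (continuous_const.mul
          (hφ.continuous.mul (continuous_const.inner hφ.continuous_gradient)))
      · exact ((hφ.2.1.mul_right).mul_left (f := fun _ => 2)).mul_left)
    (((continuous_const.inner continuous_id).mul
      (hφ.continuous.mul hφ.continuous)).integrable_of_hasCompactSupport csφ.mul_left)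
    (fun x _ => (innerSL ℝ e).differentiableAt)
    (fun x _ => (hφ.differentiable x).mul (hφ.differentiable x))
  simp_rw [hf, hd, one_mul] at key
  have e1 : ∫ x, φ x * φ x = ‖hφ.toL2‖ ^ 2 := by
    rw [← real_inner_self_eq_norm_sq, L2.inner_def,
      ← setIntegral_eq_integral_of_forall_compl_eq_zero (s := Ω)]
    · refine integral_congr_ae ?_
      filter_upwards [hφ.coeFn_toL2] with x hx
      rw [hx]
      simp [sq]
    · intro x hx
      rw [hφ.eq_zero hx, zero_mul]
  have e2 : ∫ x, inner ℝ e x * (2 * (φ x * inner ℝ e (gradient φ x)))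
      = 2 * inner ℝ H hφ.gradL2 := by
    rw [L2.inner_def, ← integral_const_mul,
      ← setIntegral_eq_integral_of_forall_compl_eq_zero (s := Ω)]
    · refine integral_congr_ae ?_
      filter_upwards [hφ.coeFn_gradL2, hmem.coeFn_toLp] with x hx hx'
      rw [hx, hH, hx', inner_smul_left]
      simp only [conj_trivial]
      ring
    · intro x hx
      rw [hφ.eq_zero hx]
      ring
  rw [e1, e2] at key
  have hcs2 : -inner ℝ H hφ.gradL2 ≤ ‖H‖ * ‖hφ.gradL2‖ :=
    (neg_le_abs _).trans (abs_real_inner_le_norm _ _)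
  have hfin : ‖hφ.toL2‖ * ‖hφ.toL2‖ ≤ ‖hφ.toL2‖ * (2 * R * ‖hφ.gradL2‖) := by
    have := mul_le_mul_of_nonneg_right hHle (norm_nonneg hφ.gradL2)
    nlinarith
  rcases (norm_nonneg hφ.toL2).eq_or_lt with h0 | h0
  · rw [← h0]
    positivity
  · exact le_of_mul_le_mul_left hfin h0

/-! ### `H¹₀(Ω)` as a closed graph -/

theorem IsTestFunction.toL2_add {φ ψ : Space d → ℝ} (hφ : IsTestFunction Ω φ)
    (hψ : IsTestFunction Ω ψ) : (hφ.add hψ).toL2 = hφ.toL2 + hψ.toL2 := rfl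

theorem IsTestFunction.gradL2_add {φ ψ : Space d → ℝ} (hφ : IsTestFunction Ω φ)
    (hψ : IsTestFunction Ω ψ) : (hφ.add hψ).gradL2 = hφ.gradL2 + hψ.gradL2 := by
  rw [gradL2, gradL2, gradL2, ← MemLp.toLp_add]
  exact MemLp.toLp_congr _ _ (.of_eq (gradient_add hφ.differentiable hψ.differentiable))

theorem IsTestFunction.toL2_smul {φ : Space d → ℝ} (c : ℝ) (hφ : IsTestFunction Ω φ) :
    (hφ.smul c).toL2 = c • hφ.toL2 := rfl

theorem IsTestFunction.gradL2_smul {φ : Space d → ℝ} (c : ℝ) (hφ : IsTestFunction Ω φ) :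
    (hφ.smul c).gradL2 = c • hφ.gradL2 := by
  rw [gradL2, gradL2, ← MemLp.toLp_const_smul]
  exact MemLp.toLp_congr _ _ (.of_eq (gradient_const_smul c hφ.differentiable))

theorem IsTestFunction.toL2_zero : (zero : IsTestFunction Ω (0 : Space d → ℝ)).toL2 = 0 := rfl

theorem IsTestFunction.gradL2_zero :
    (zero : IsTestFunction Ω (0 : Space d → ℝ)).gradL2 = 0 := by
  have h : gradient (0 : Space d → ℝ) = 0 := by
    funext x
    simp [gradient]
  rw [Lp.eq_zero_iff_ae_eq_zero]
  exact zero.coeFn_gradL2.trans (.of_eq h)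

/-- The pairs `(φ, ∇φ)` of test functions and their gradients. -/
def testPairs (Ω : Set (Space d)) : Submodule ℝ (WithLp 2 (L2 Ω × L2Vec Ω)) where
  carrier := {z | ∃ (φ : Space d → ℝ) (hφ : IsTestFunction Ω φ),
    z = WithLp.toLp 2 (hφ.toL2, hφ.gradL2)}
  zero_mem' := ⟨0, .zero, by
    rw [IsTestFunction.toL2_zero, IsTestFunction.gradL2_zero]; rfl⟩
  add_mem' := by
    rintro _ _ ⟨φ, hφ, rfl⟩ ⟨ψ, hψ, rfl⟩
    exact ⟨φ + ψ, hφ.add hψ, by rw [hφ.toL2_add hψ, hφ.gradL2_add hψ]; rfl⟩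
  smul_mem' := by
    rintro c _ ⟨φ, hφ, rfl⟩
    exact ⟨c • φ, hφ.smul c, by rw [hφ.toL2_smul, hφ.gradL2_smul]; rfl⟩

/-- The graph of the gradient on `H¹₀(Ω)`, as the closure of the pairs `(φ, ∇φ)`. -/
def gradGraph (Ω : Set (Space d)) : Submodule ℝ (WithLp 2 (L2 Ω × L2Vec Ω)) :=
  (testPairs Ω).topologicalClosure

theorem isClosed_gradGraph : IsClosed (gradGraph Ω : Set (WithLp 2 (L2 Ω × L2Vec Ω))) :=
  (testPairs Ω).isClosed_topologicalClosure

instance : CompleteSpace (gradGraph Ω) := isClosed_gradGraph.completeSpace_coe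

theorem test_mem_gradGraph {φ : Space d → ℝ} (hφ : IsTestFunction Ω φ) :
    WithLp.toLp 2 (hφ.toL2, hφ.gradL2) ∈ gradGraph Ω :=
  (testPairs Ω).le_topologicalClosure ⟨φ, hφ, rfl⟩

theorem continuous_fst : Continuous fun z : WithLp 2 (L2 Ω × L2Vec Ω) => z.fst :=
  (WithLp.fstL 2 ℝ (L2 Ω) (L2Vec Ω)).continuous

theorem continuous_snd : Continuous fun z : WithLp 2 (L2 Ω × L2Vec Ω) => z.snd :=
  (WithLp.sndL 2 ℝ (L2 Ω) (L2Vec Ω)).continuous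

/-- Density principle: a property closed in the graph norm need only be checked on test functions.
-/
theorem gradGraph_induction {p : L2 Ω → L2Vec Ω → Prop}
    (hp : IsClosed {z : WithLp 2 (L2 Ω × L2Vec Ω) | p z.fst z.snd})
    (h : ∀ (φ : Space d → ℝ) (hφ : IsTestFunction Ω φ), p hφ.toL2 hφ.gradL2)
    {z : WithLp 2 (L2 Ω × L2Vec Ω)} (hz : z ∈ gradGraph Ω) : p z.fst z.snd := by
  refine closure_minimal (s := (testPairs Ω : Set (WithLp 2 (L2 Ω × L2Vec Ω)))) ?_ hp
    (show z ∈ closure _ from hz)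
  rintro _ ⟨φ, hφ, rfl⟩
  exact h φ hφ

theorem isWeakGradient_of_mem_gradGraph {z : WithLp 2 (L2 Ω × L2Vec Ω)}
    (hz : z ∈ gradGraph Ω) : IsWeakGradient z.fst z.snd := by
  refine gradGraph_induction (p := IsWeakGradient) ?_ (fun φ hφ => hφ.isWeakGradient) hz
  -- Written with inner products against fixed `L²` elements, being a weak gradient is an
  -- intersection of closed conditions.
  simp_rw [isWeakGradient_iff, Set.ofPred_forall]
  refine isClosed_iInter fun φ => isClosed_iInter fun hφ => isClosed_iInter fun e => ?_
  exact isClosed_eq ((continuous_fst.inner continuous_const).add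
    (continuous_snd.inner continuous_const)) continuous_const

theorem eLpNorm_sub_coeFn {E : Type*} [NormedAddCommGroup E] (F : Lp E 2 (volume.restrict Ω))
    {g : Space d → E} (hg : MemLp g 2 (volume.restrict Ω)) :
    eLpNorm (fun x => F x - g x) 2 (volume.restrict Ω) = ENNReal.ofReal ‖F - hg.toLp g‖ := by
  rw [ofReal_norm, Lp.enorm_def]
  refine eLpNorm_congr_ae ?_
  filter_upwards [Lp.coeFn_sub F (hg.toLp g), hg.coeFn_toLp] with x h1 h2
  rw [h1, Pi.sub_apply, h2]

theorem norm_fst_le (z : WithLp 2 (L2 Ω × L2Vec Ω)) : ‖z.fst‖ ≤ ‖z‖ :=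
  abs_le_of_sq_le_sq' (by rw [WithLp.prod_norm_sq_eq_of_L2]; nlinarith [sq_nonneg ‖z.snd‖])
    (norm_nonneg _) |>.2

theorem norm_snd_le (z : WithLp 2 (L2 Ω × L2Vec Ω)) : ‖z.snd‖ ≤ ‖z‖ :=
  abs_le_of_sq_le_sq' (by rw [WithLp.prod_norm_sq_eq_of_L2]; nlinarith [sq_nonneg ‖z.fst‖])
    (norm_nonneg _) |>.2

theorem norm_le_add (z : WithLp 2 (L2 Ω × L2Vec Ω)) : ‖z‖ ≤ ‖z.fst‖ + ‖z.snd‖ :=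
  abs_le_of_sq_le_sq' (by
    rw [WithLp.prod_norm_sq_eq_of_L2]
    nlinarith [mul_nonneg (norm_nonneg z.fst) (norm_nonneg z.snd)]) (by positivity) |>.2

/-- Approximation in both `eLpNorm` conditions of `H10` amounts to approximation in the product
norm, and uniqueness of weak gradients identifies the second component. This transfers linearity and
density from the graph to `H10` and `grad`. -/
theorem mem_gradGraph_iff (hΩ : IsOpen Ω) {z : WithLp 2 (L2 Ω × L2Vec Ω)} :
    z ∈ gradGraph Ω ↔ z.fst ∈ H10 Ω ∧ grad z.fst = z.snd := by
  constructor
  · intro hz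
    have hw := isWeakGradient_of_mem_gradGraph hz
    have hg := hw.grad_eq hΩ
    refine ⟨⟨⟨_, hw⟩, fun ε hε => ?_⟩, hg⟩
    -- The tolerance may be `∞`, so a positive real one below it is chosen.
    obtain ⟨δ, hδ, hδε⟩ : ∃ δ : ℝ, 0 < δ ∧ ENNReal.ofReal δ ≤ ε := by
      rcases eq_or_ne ε ∞ with rfl | h
      · exact ⟨1, one_pos, le_top⟩
      · exact ⟨ε.toReal, ENNReal.toReal_pos hε.ne' h, (ENNReal.ofReal_toReal h).le⟩
    obtain ⟨_, ⟨φ, hφ, rfl⟩, hd⟩ := Metric.mem_closure_iff.1 (show z ∈ closure _ from hz) δ hδ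
    rw [dist_eq_norm] at hd
    refine ⟨φ, hφ, ?_, ?_⟩
    · rw [eLpNorm_sub_coeFn _ hφ.memLp]
      exact ((ENNReal.ofReal_lt_ofReal_iff hδ).2 ((norm_fst_le _).trans_lt hd)).trans_le hδε
    · rw [hg, eLpNorm_sub_coeFn _ hφ.memLp_gradient]
      exact ((ENNReal.ofReal_lt_ofReal_iff hδ).2 ((norm_snd_le _).trans_lt hd)).trans_le hδε
  · rintro ⟨⟨-, h⟩, hg⟩
    refine Metric.mem_closure_iff.2 fun ε hε => ?_
    obtain ⟨φ, hφ, h1, h2⟩ := h (ENNReal.ofReal (ε / 2)) (by simpa using hε)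
    rw [eLpNorm_sub_coeFn _ hφ.memLp, ENNReal.ofReal_lt_ofReal_iff (half_pos hε)] at h1
    rw [eLpNorm_sub_coeFn _ hφ.memLp_gradient, ENNReal.ofReal_lt_ofReal_iff (half_pos hε),
      hg] at h2
    refine ⟨WithLp.toLp 2 (hφ.toL2, hφ.gradL2), ⟨φ, hφ, rfl⟩, ?_⟩
    rw [dist_eq_norm]
    refine (norm_le_add (z - WithLp.toLp 2 (hφ.toL2, hφ.gradL2))).trans_lt ?_
    have h3 : ‖z.fst - hφ.toL2‖ + ‖z.snd - hφ.gradL2‖ < ε :=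
      (add_lt_add h1 h2).trans_eq (add_halves ε)
    exact h3

theorem pair_mem_gradGraph (hΩ : IsOpen Ω) {w : L2 Ω} (hw : w ∈ H10 Ω) :
    WithLp.toLp 2 (w, grad w) ∈ gradGraph Ω :=
  (mem_gradGraph_iff hΩ).2 ⟨hw, rfl⟩

theorem IsTestFunction.mem_H10 (hΩ : IsOpen Ω) {φ : Space d → ℝ} (hφ : IsTestFunction Ω φ) :
    hφ.toL2 ∈ H10 Ω :=
  ((mem_gradGraph_iff hΩ).1 (test_mem_gradGraph hφ)).1

theorem IsTestFunction.grad_toL2 (hΩ : IsOpen Ω) {φ : Space d → ℝ}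
    (hφ : IsTestFunction Ω φ) : grad hφ.toL2 = hφ.gradL2 :=
  ((mem_gradGraph_iff hΩ).1 (test_mem_gradGraph hφ)).2

theorem sub_mem_H10 (hΩ : IsOpen Ω) {v w : L2 Ω} (hv : v ∈ H10 Ω) (hw : w ∈ H10 Ω) :
    v - w ∈ H10 Ω :=
  ((mem_gradGraph_iff hΩ).1
    ((gradGraph Ω).sub_mem (pair_mem_gradGraph hΩ hv) (pair_mem_gradGraph hΩ hw))).1

theorem grad_sub (hΩ : IsOpen Ω) {v w : L2 Ω} (hv : v ∈ H10 Ω) (hw : w ∈ H10 Ω) :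
    grad (v - w) = grad v - grad w :=
  ((mem_gradGraph_iff hΩ).1
    ((gradGraph Ω).sub_mem (pair_mem_gradGraph hΩ hv) (pair_mem_gradGraph hΩ hw))).2

/-! ### Green's formula and the Friedrichs inequality on `H¹₀(Ω)` -/

theorem IsWeakDivergence.inner_grad (hΩ : IsOpen Ω) {τ : L2Vec Ω} {g : L2 Ω}
    (h : IsWeakDivergence τ g) {w : L2 Ω} (hw : w ∈ H10 Ω) :
    inner ℝ τ (grad w) + inner ℝ g w = 0 := by
  refine gradGraph_induction (p := fun w G => inner ℝ τ G + inner ℝ g w = 0) ?_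
    (isWeakDivergence_iff.1 h) (pair_mem_gradGraph hΩ hw)
  exact isClosed_eq ((continuous_const.inner continuous_snd).add
    (continuous_const.inner continuous_fst)) continuous_const

theorem inner_divergence (hΩ : IsOpen Ω) {τ : L2Vec Ω} (hτ : τ ∈ Hdiv Ω) {w : L2 Ω}
    (hw : w ∈ H10 Ω) : inner ℝ (divergence τ) w = -inner ℝ τ (grad w) := by
  obtain ⟨g, hg⟩ := hτ
  rw [hg.divergence_eq hΩ]
  linarith [hg.inner_grad hΩ hw]

/-- Test functions belong to `H10`, so a weak equation already determines the divergence of its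
flux; this puts exact fluxes into `Hdiv`. -/
theorem isWeakDivergence_of_forall_H10 (hΩ : IsOpen Ω) {τ : L2Vec Ω} {g : L2 Ω}
    (h : ∀ w ∈ H10 Ω, inner ℝ τ (grad w) = inner ℝ g w) : IsWeakDivergence τ (-g) :=
  isWeakDivergence_iff.2 fun φ hφ => by
    rw [← hφ.grad_toL2 hΩ, h _ (hφ.mem_H10 hΩ), inner_neg_left, add_neg_cancel]

theorem norm_le_mul_norm_grad (hΩ : IsOpen Ω) {R : ℝ} (hR0 : 0 ≤ R)
    (hR : ∀ x ∈ Ω, ‖x‖ ≤ R) {e : Space d} (he : ‖e‖ = 1) {w : L2 Ω} (hw : w ∈ H10 Ω) :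
    ‖w‖ ≤ 2 * R * ‖grad w‖ := by
  have hclosed : IsClosed {z : WithLp 2 (L2 Ω × L2Vec Ω) | ‖z.fst‖ ≤ 2 * R * ‖z.snd‖} :=
    isClosed_le continuous_fst.norm (continuous_const.mul continuous_snd.norm)
  have h := gradGraph_induction (p := fun w G => ‖w‖ ≤ 2 * R * ‖G‖) hclosed
    (fun φ hφ => hφ.norm_toL2_le hΩ hR0 hR he) (pair_mem_gradGraph hΩ hw)
  exact h

theorem exists_isFriedrichsConstant (hd : 0 < d) (hΩ : IsOpen Ω)
    (hΩb : Bornology.IsBounded Ω) : ∃ C : ℝ, IsFriedrichsConstant Ω C := by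
  obtain ⟨R, hR0, hR⟩ := hΩb.exists_pos_norm_le
  obtain ⟨e, he⟩ : ∃ e : Space d, ‖e‖ = 1 := ⟨EuclideanSpace.single ⟨0, hd⟩ 1, by simp⟩
  exact ⟨2 * R, by positivity, fun w hw => norm_le_mul_norm_grad hΩ hR0.le hR he hw⟩

/-! ### The diffusion form and the solution operator -/

namespace Problem

variable (P : Problem Ω)

theorem coeFn_coeffMul (G : L2Vec Ω) :
    P.coeffMul G =ᵐ[volume.restrict Ω] fun x => P.ν x • G x :=
  MemLp.coeFn_toLp _

/-- Multiplication by the coefficient as a continuous linear operator. -/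
def coeffMulL : L2Vec Ω →L[ℝ] L2Vec Ω :=
  LinearMap.mkContinuous
    { toFun := P.coeffMul
      map_add' := fun G H => by
        refine Lp.ext ?_
        filter_upwards [P.coeFn_coeffMul (G + H), P.coeFn_coeffMul G, P.coeFn_coeffMul H,
          Lp.coeFn_add G H, Lp.coeFn_add (P.coeffMul G) (P.coeffMul H)] with x h1 h2 h3 h4 h5
        rw [h1, h5, Pi.add_apply, h2, h3, h4, Pi.add_apply, smul_add]
      map_smul' := fun c G => by
        refine Lp.ext ?_
        filter_upwards [P.coeFn_coeffMul (c • G), P.coeFn_coeffMul G,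
          Lp.coeFn_smul c G, Lp.coeFn_smul c (P.coeffMul G)] with x h1 h2 h3 h4
        rw [h1, RingHom.id_apply, h4, Pi.smul_apply, h2, h3, Pi.smul_apply, smul_comm] }
    P.νup fun G => by
      refine Lp.norm_le_mul_norm_of_ae_le_mul ?_
      filter_upwards [P.coeFn_coeffMul G, P.ν_bounds] with x h1 hx
      rw [LinearMap.coe_mk, AddHom.coe_mk, h1, norm_smul,
        Real.norm_of_nonneg (P.νlow_pos.le.trans hx.1)]
      exact mul_le_mul_of_nonneg_right hx.2 (norm_nonneg _)

theorem coeffMulL_apply (G : L2Vec Ω) : P.coeffMulL G = P.coeffMul G := rfl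

theorem inner_coeffMul_comm (G H : L2Vec Ω) :
    inner ℝ (P.coeffMul G) H = inner ℝ (P.coeffMul H) G := by
  rw [L2.inner_def, L2.inner_def]
  refine integral_congr_ae ?_
  filter_upwards [P.coeFn_coeffMul G, P.coeFn_coeffMul H] with x h1 h2
  rw [h1, h2, inner_smul_left, inner_smul_left, real_inner_comm]

theorem mul_norm_sq_le_inner_coeffMul (G : L2Vec Ω) :
    P.νlow * ‖G‖ ^ 2 ≤ inner ℝ (P.coeffMul G) G := by
  rw [← real_inner_self_eq_norm_sq, L2.inner_def, L2.inner_def, ← integral_const_mul]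
  refine integral_mono_ae ((L2.integrable_inner G G).const_mul _) (L2.integrable_inner _ _) ?_
  filter_upwards [P.coeFn_coeffMul G, P.ν_bounds] with x h1 h2
  rw [h1, inner_smul_left]
  exact mul_le_mul_of_nonneg_right h2.1 real_inner_self_nonneg

theorem flux_sub (hΩ : IsOpen Ω) {v w : L2 Ω} (hv : v ∈ H10 Ω) (hw : w ∈ H10 Ω) :
    P.flux (v - w) = P.flux v - P.flux w := by
  rw [flux, grad_sub hΩ hv hw, ← coeffMulL_apply, map_sub]
  rfl

/-- The bilinear form `(ν ∇v, ∇w)` on `H¹₀(Ω)`. -/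
def form : gradGraph Ω →L[ℝ] gradGraph Ω →L[ℝ] ℝ :=
  (innerSL ℝ).bilinearComp
    (P.coeffMulL ∘L WithLp.sndL 2 ℝ (L2 Ω) (L2Vec Ω) ∘L (gradGraph Ω).subtypeL)
    (WithLp.sndL 2 ℝ (L2 Ω) (L2Vec Ω) ∘L (gradGraph Ω).subtypeL)

theorem form_apply (v w : gradGraph Ω) :
    P.form v w = inner ℝ (P.coeffMul v.1.snd) w.1.snd := rfl

theorem isCoercive_form (hΩ : IsOpen Ω) {C : ℝ} (hC : IsFriedrichsConstant Ω C) :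
    IsCoercive P.form := by
  -- The Friedrichs inequality bounds the squared graph norm by `(C² + 1) ‖∇w‖²`, which fixes the
  -- coercivity constant.
  refine ⟨P.νlow / (C ^ 2 + 1), div_pos P.νlow_pos (by positivity), fun v => ?_⟩
  obtain ⟨hv, hg⟩ := (mem_gradGraph_iff hΩ).1 v.2
  have h1 : ‖v.1.fst‖ ≤ C * ‖v.1.snd‖ := hg ▸ hC.2 _ hv
  have h2 : ‖v‖ ^ 2 ≤ (C ^ 2 + 1) * ‖v.1.snd‖ ^ 2 := by
    rw [show ‖v‖ = ‖v.1‖ from rfl, WithLp.prod_norm_sq_eq_of_L2]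
    nlinarith [pow_le_pow_left₀ (norm_nonneg _) h1 2]
  rw [form_apply]
  refine le_trans ?_ (P.mul_norm_sq_le_inner_coeffMul v.1.snd)
  rw [mul_assoc, ← sq, div_mul_eq_mul_div, div_le_iff₀ (by positivity), mul_assoc]
  refine mul_le_mul_of_nonneg_left ?_ P.νlow_pos.le
  linarith

theorem exists_solutionOperator (hΩ : IsOpen Ω) {C : ℝ} (hC : IsFriedrichsConstant Ω C) :
    ∃ S : L2 Ω →L[ℝ] L2 Ω, ∀ g : L2 Ω, S g ∈ H10 Ω ∧
      ∀ w ∈ H10 Ω, inner ℝ (P.flux (S g)) (grad w) = inner ℝ g w := by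
  let F : gradGraph Ω →L[ℝ] L2 Ω := WithLp.fstL 2 ℝ (L2 Ω) (L2Vec Ω) ∘L (gradGraph Ω).subtypeL
  let A := (P.isCoercive_form hΩ hC).continuousLinearEquivOfBilin
  -- `F` is the embedding of the graph into `L²`; its adjoint represents `w ↦ (g, w)` there, and `A`
  -- represents the form. Thus `S = F A⁻¹ F*`, with linearity and continuity built in.
  refine ⟨F ∘L (A.symm : gradGraph Ω →L[ℝ] gradGraph Ω) ∘L ContinuousLinearMap.adjoint F,
    fun g => ?_⟩
  set y : gradGraph Ω := A.symm (ContinuousLinearMap.adjoint F g) with hy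
  obtain ⟨hyH, hyg⟩ := (mem_gradGraph_iff hΩ).1 y.2
  refine ⟨hyH, fun w hw => ?_⟩
  let W : gradGraph Ω := ⟨_, pair_mem_gradGraph hΩ hw⟩
  have h := (P.isCoercive_form hΩ hC).continuousLinearEquivOfBilin_apply y W
  have h2 : A y = ContinuousLinearMap.adjoint F g := A.apply_symm_apply _
  rw [show (P.isCoercive_form hΩ hC).continuousLinearEquivOfBilin y = A y from rfl, h2,
    ContinuousLinearMap.adjoint_inner_left, form_apply, ← hyg] at h
  exact h.symm

end Problem

/-! ### Weak solutions and the residual error bound -/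

namespace Problem

variable (P : Problem Ω)

/-- The weak solution of `- div (ν ∇y) = g`. -/
def IsWeakSolution (g y : L2 Ω) : Prop :=
  y ∈ H10 Ω ∧ ∀ w ∈ H10 Ω, inner ℝ (P.flux y) (grad w) = inner ℝ g w

variable {P}

theorem IsWeakSolution.sub (hΩ : IsOpen Ω) {g g' y y' : L2 Ω} (h : P.IsWeakSolution g y)
    (h' : P.IsWeakSolution g' y') : P.IsWeakSolution (g - g') (y - y') :=
  ⟨sub_mem_H10 hΩ h.1 h'.1, fun w hw => by
    rw [P.flux_sub hΩ h.1 h'.1, inner_sub_left, inner_sub_left, h.2 w hw, h'.2 w hw]⟩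

/-- Self-adjointness of the solution operator: each equation is tested with the other solution, and
the form is symmetric. -/
theorem IsWeakSolution.inner_comm {g h y p : L2 Ω} (hy : P.IsWeakSolution g y)
    (hp : P.IsWeakSolution h p) : inner ℝ g p = inner ℝ h y := by
  rw [← hy.2 p hp.1, ← hp.2 y hy.1]
  exact P.inner_coeffMul_comm _ _

theorem IsWeakSolution.flux_isWeakDivergence (hΩ : IsOpen Ω) {g y : L2 Ω}
    (h : P.IsWeakSolution g y) : IsWeakDivergence (P.flux y) (-g) :=
  isWeakDivergence_of_forall_H10 hΩ h.2

theorem IsWeakSolution.divergence_flux (hΩ : IsOpen Ω) {g y : L2 Ω}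
    (h : P.IsWeakSolution g y) : divergence (P.flux y) = -g :=
  (h.flux_isWeakDivergence hΩ).divergence_eq hΩ

/-- The residual form of the equation for the error `y - η`. -/
theorem IsWeakSolution.inner_flux_sub (hΩ : IsOpen Ω) {g y η : L2 Ω} {τ : L2Vec Ω}
    (h : P.IsWeakSolution g y) (hη : η ∈ H10 Ω) (hτ : τ ∈ Hdiv Ω) {w : L2 Ω} (hw : w ∈ H10 Ω) :
    inner ℝ (P.flux (y - η)) (grad w)
      = inner ℝ (g + divergence τ) w + inner ℝ (τ - P.flux η) (grad w) := by
  rw [P.flux_sub hΩ h.1 hη, inner_sub_left, inner_sub_left, inner_add_left, h.2 w hw,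
    inner_divergence hΩ hτ hw]
  ring

/-- The residual equation is tested with the error `y - η` itself. Coercivity bounds the left side
below, Cauchy–Schwarz and Friedrichs bound the right side, and one factor `‖∇(y - η)‖` cancels. -/
theorem IsWeakSolution.norm_grad_sub_le (hΩ : IsOpen Ω) {C : ℝ}
    (hC : IsFriedrichsConstant Ω C) {g y η : L2 Ω} {τ : L2Vec Ω}
    (h : P.IsWeakSolution g y) (hη : η ∈ H10 Ω) (hτ : τ ∈ Hdiv Ω) :
    ‖grad (y - η)‖ ≤ 1 / P.νlow * (C * ‖g + divergence τ‖ + ‖τ - P.flux η‖) := by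
  have he := sub_mem_H10 hΩ h.1 hη
  have h1 := P.mul_norm_sq_le_inner_coeffMul (grad (y - η))
  rw [show P.coeffMul (grad (y - η)) = P.flux (y - η) from rfl,
    h.inner_flux_sub hΩ hη hτ he] at h1
  have h2 := real_inner_le_norm (g + divergence τ) (y - η)
  have h3 := real_inner_le_norm (τ - P.flux η) (grad (y - η))
  have h4 := mul_le_mul_of_nonneg_left (hC.2 _ he) (norm_nonneg (g + divergence τ))
  rw [one_div, ← div_eq_inv_mul, le_div_iff₀ P.νlow_pos]
  rcases (norm_nonneg (grad (y - η))).eq_or_lt with h0 | h0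
  · rw [← h0, zero_mul]
    have := hC.1
    positivity
  · refine le_of_mul_le_mul_right ?_ h0
    nlinarith

theorem IsWeakSolution.unique (hΩ : IsOpen Ω) {C : ℝ} (hC : IsFriedrichsConstant Ω C)
    {g y y' : L2 Ω} (h : P.IsWeakSolution g y) (h' : P.IsWeakSolution g y') : y = y' := by
  -- With `η = y'` and `τ` its exact flux, both residuals in the error bound are zero.
  have h1 := h.norm_grad_sub_le hΩ hC h'.1 ⟨_, h'.flux_isWeakDivergence hΩ⟩
  rw [h'.divergence_flux hΩ, add_neg_cancel, sub_self, norm_zero, norm_zero, mul_zero,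
    add_zero, mul_zero] at h1
  have h2 := hC.2 _ (sub_mem_H10 hΩ h.1 h'.1)
  have h3 : ‖y - y'‖ ≤ 0 := h2.trans (mul_nonpos_of_nonneg_of_nonpos hC.1.le h1)
  exact sub_eq_zero.1 (norm_le_zero_iff.1 h3)

/-! ### Admissible controls and projections onto convex sets -/

variable (P)

theorem Uad_eq_Icc : P.Uad = Set.Icc P.ua P.ub := rfl

theorem convex_Uad : Convex ℝ P.Uad := by
  rintro v ⟨hv1, hv2⟩ w ⟨hw1, hw2⟩ a b ha hb hab
  rw [← Lp.coeFn_le] at hv1 hv2 hw1 hw2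
  obtain rfl : b = 1 - a := by linarith
  constructor <;> rw [← Lp.coeFn_le]
  · filter_upwards [hv1, hw1, Lp.coeFn_add (a • v) ((1 - a) • w), Lp.coeFn_smul a v,
      Lp.coeFn_smul (1 - a) w] with x h1 h2 h3 h4 h5
    rw [h3, Pi.add_apply, h4, h5, Pi.smul_apply, Pi.smul_apply, smul_eq_mul, smul_eq_mul]
    nlinarith [mul_le_mul_of_nonneg_left h1 ha, mul_le_mul_of_nonneg_left h2 hb]
  · filter_upwards [hv2, hw2, Lp.coeFn_add (a • v) ((1 - a) • w), Lp.coeFn_smul a v,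
      Lp.coeFn_smul (1 - a) w] with x h1 h2 h3 h4 h5
    rw [h3, Pi.add_apply, h4, h5, Pi.smul_apply, Pi.smul_apply, smul_eq_mul, smul_eq_mul]
    nlinarith [mul_le_mul_of_nonneg_left h1 ha, mul_le_mul_of_nonneg_left h2 hb]

theorem control_mem_Uad (ζ : L2 Ω) : P.control ζ ∈ P.Uad :=
  ⟨le_inf P.ua_le_ub le_sup_left, inf_le_left⟩

/-- The clamped value is the projection of `s` onto `[a, b]`; this is its variational inequality. -/
theorem clamp_sub_mul_nonneg {a b s w : ℝ} (ha : a ≤ w) (hb : w ≤ b) :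
    0 ≤ (b ⊓ (a ⊔ s) - s) * (w - b ⊓ (a ⊔ s)) := by
  rcases le_total a s with h1 | h1
  · rw [sup_eq_right.2 h1]
    rcases le_total b s with h2 | h2
    · rw [inf_eq_left.2 h2]
      exact mul_nonneg_of_nonpos_of_nonpos (by linarith) (by linarith)
    · rw [inf_eq_right.2 h2, sub_self, zero_mul]
  · rw [sup_eq_left.2 h1, inf_eq_right.2 (ha.trans hb)]
    exact mul_nonneg (by linarith) (by linarith)

theorem control_inner_nonneg (ζ : L2 Ω) {w : L2 Ω} (hw : w ∈ P.Uad) :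
    0 ≤ inner ℝ (ζ + P.lam • (P.control ζ - P.ud)) (w - P.control ζ) := by
  have hl := P.lam_pos
  obtain ⟨hw1, hw2⟩ := hw
  rw [← Lp.coeFn_le] at hw1 hw2
  rw [L2.inner_def]
  refine integral_nonneg_of_ae ?_
  filter_upwards [hw1, hw2, Lp.coeFn_add ζ (P.lam • (P.control ζ - P.ud)),
    Lp.coeFn_smul P.lam (P.control ζ - P.ud), Lp.coeFn_sub (P.control ζ) P.ud,
    Lp.coeFn_sub w (P.control ζ), Lp.coeFn_inf P.ub (P.ua ⊔ (P.ud - (1 / P.lam) • ζ)),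
    Lp.coeFn_sup P.ua (P.ud - (1 / P.lam) • ζ), Lp.coeFn_sub P.ud ((1 / P.lam) • ζ),
    Lp.coeFn_smul (1 / P.lam) ζ] with x h1 h2 h3 h4 h5 h6 h7 h8 h9 h10
  have hc : P.control ζ x = P.ub x ⊓ (P.ua x ⊔ (P.ud x - 1 / P.lam * ζ x)) := by
    rw [control, h7, Pi.inf_apply, h8, Pi.sup_apply, h9, Pi.sub_apply, h10, Pi.smul_apply,
      smul_eq_mul]
  have key := clamp_sub_mul_nonneg (s := P.ud x - 1 / P.lam * ζ x) h1 h2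
  rw [← hc] at key
  rw [h3, Pi.add_apply, h4, Pi.smul_apply, h5, h6, Pi.sub_apply, Pi.sub_apply]
  -- Pointwise, `ζ + lam (c - ud) = lam (c - (ud - ζ / lam))`, so the clamp inequality applies with
  -- `s = ud - ζ / lam`.
  have : inner ℝ (ζ x + P.lam • (P.control ζ x - P.ud x)) (w x - P.control ζ x)
      = P.lam * ((P.control ζ x - (P.ud x - 1 / P.lam * ζ x)) * (w x - P.control ζ x)) := by
    simp only [RCLike.inner_apply, conj_trivial, smul_eq_mul]
    simp
    field_simp
    ring
  rw [this]
  exact mul_nonneg hl.le key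

/-- Each of `u` and `control ζ` is tested in the variational inequality of the other; the sum of the
two is `-lam ‖control ζ - u‖²`. -/
theorem eq_control {u ζ : L2 Ω} (hu : u ∈ P.Uad)
    (h : ∀ w ∈ P.Uad, 0 ≤ inner ℝ (ζ + P.lam • (u - P.ud)) (w - u)) : P.control ζ = u := by
  have h1 := h _ (P.control_mem_Uad ζ)
  have h2 := P.control_inner_nonneg ζ hu
  set c := P.control ζ
  have h3 : inner ℝ (ζ + P.lam • (u - P.ud)) (c - u) + inner ℝ (ζ + P.lam • (c - P.ud)) (u - c)
      = -(P.lam * ‖c - u‖ ^ 2) := by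
    rw [← neg_sub c u, inner_neg_right, ← sub_eq_add_neg, ← inner_sub_left,
      show ζ + P.lam • (u - P.ud) - (ζ + P.lam • (c - P.ud)) = (-P.lam) • (c - u) by module,
      inner_smul_left, conj_trivial, real_inner_self_eq_norm_sq, neg_mul]
  have h4 : P.lam * ‖c - u‖ ^ 2 ≤ 0 := by linarith
  have h5 : ‖c - u‖ ^ 2 ≤ 0 := by
    by_contra hn
    exact absurd (mul_pos P.lam_pos (not_le.1 hn)) (not_lt.2 h4)
  exact sub_eq_zero.1 (norm_eq_zero.1 (pow_eq_zero_iff two_ne_zero |>.1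
    (le_antisymm h5 (sq_nonneg _))))

/-- The point of an image `T '' K` closest to a given point. -/
theorem exists_forall_inner_le_zero {E F : Type*} [NormedAddCommGroup E] [InnerProductSpace ℝ E]
    [CompleteSpace E] [NormedAddCommGroup F] [InnerProductSpace ℝ F] {K : Set E}
    (hne : K.Nonempty) (hK : IsClosed K) (hconv : Convex ℝ K) (S : E →L[ℝ] F) {l : ℝ}
    (hl : 0 < l) (a : F) (b : E) :
    ∃ u ∈ K, ∀ w ∈ K, inner ℝ (a - S u) (S (w - u)) + l * inner ℝ (b - u) (w - u) ≤ 0 := by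
  -- With `T x = (S x, √l x)`, the squared distance from `T x` to `(a, √l b)` is `‖a - S x‖² + l ‖b
  -- - x‖²`.
  let T : E →L[ℝ] WithLp 2 (F × E) :=
    ((WithLp.prodContinuousLinearEquiv 2 ℝ F E).symm : F × E →L[ℝ] WithLp 2 (F × E)) ∘L
      S.prod (√l • ContinuousLinearMap.id ℝ E)
  have hs : 0 < √l := Real.sqrt_pos.2 hl
  -- The second component bounds `T` below by `√l`, so `T '' K` is complete even if `S` has no
  -- closed range.
  have hanti : AntilipschitzWith (√l)⁻¹.toNNReal T := by
    refine T.antilipschitz_of_bound fun x => ?_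
    rw [Real.coe_toNNReal _ (inv_nonneg.2 hs.le), ← div_eq_inv_mul, le_div_iff₀ hs]
    refine abs_le_of_sq_le_sq' ?_ (norm_nonneg _) |>.2
    rw [WithLp.prod_norm_sq_eq_of_L2]
    have h1 : ‖(T x).snd‖ ^ 2 = (‖x‖ * √l) ^ 2 := by
      rw [show (T x).snd = √l • x from rfl, norm_smul, Real.norm_of_nonneg hs.le, mul_comm]
    rw [h1]
    nlinarith [sq_nonneg ‖(T x).fst‖]
  have hcomp : IsComplete (T '' K) :=
    (hanti.isUniformInducing T.uniformContinuous).isComplete_iff.2 hK.isComplete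
  have hconv' : Convex ℝ (T '' K) := hconv.linear_image T.toLinearMap
  obtain ⟨_, ⟨u, hu, rfl⟩, hmin⟩ :=
    exists_norm_eq_iInf_of_complete_convex (hne.image T) hcomp hconv' (WithLp.toLp 2 (a, √l • b))
  refine ⟨u, hu, fun w hw => ?_⟩
  have h := (norm_eq_iInf_iff_real_inner_le_zero hconv' ⟨u, hu, rfl⟩).1 hmin _ ⟨w, hw, rfl⟩
  rw [← map_sub, WithLp.prod_inner_apply] at h
  have h2 : inner ℝ (√l • b - √l • u) (√l • (w - u)) = l * inner ℝ (b - u) (w - u) := by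
    rw [← smul_sub, inner_smul_left, inner_smul_right, conj_trivial, ← mul_assoc,
      Real.mul_self_sqrt hl.le]
  rw [← h2]
  exact h

/-! ### The optimality system and the optimal control problem -/

theorem exists_solvesOptimalitySystem (hΩ : IsOpen Ω) {C : ℝ}
    (hC : IsFriedrichsConstant Ω C) : ∃ y u p : L2 Ω, P.SolvesOptimalitySystem y u p := by
  obtain ⟨S, hS⟩ := P.exists_solutionOperator hΩ hC
  have hclosed : IsClosed P.Uad := by
    rw [P.Uad_eq_Icc]
    exact isClosed_Icc
  -- The target `yd - S f` appears because `y(v) - yd = S v - (yd - S f)`.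
  obtain ⟨u, hu, hmin⟩ := exists_forall_inner_le_zero (K := P.Uad) ⟨P.ua, le_rfl, P.ua_le_ub⟩ hclosed
    P.convex_Uad S P.lam_pos (P.yd - S P.f) P.ud
  refine ⟨S (P.f + u), u, S (S (P.f + u) - P.yd), hS _, hS _, hu, fun w hw => ?_⟩
  have h1 := hmin w hw
  have h2 : inner ℝ (w - u) (S (S (P.f + u) - P.yd)) = inner ℝ (S (P.f + u) - P.yd) (S (w - u)) :=
    IsWeakSolution.inner_comm (P := P) (hS _) (hS _)
  rw [inner_add_left, inner_smul_left, conj_trivial, real_inner_comm, h2]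
  rw [show P.yd - S P.f - S u = -(S (P.f + u) - P.yd) by rw [map_add]; abel, inner_neg_left,
    show P.ud - u = -(u - P.ud) by abel, inner_neg_left] at h1
  linarith

variable {P}

/-- The cost is quadratic. Its linear part at `(y, u)` is `(y - yd, z - y) + lam (u - ud, v - u)`;
the adjoint state turns this into `(p + lam (u - ud), v - u) ≥ 0`, and the remaining squares are the
growth terms. -/
theorem SolvesOptimalitySystem.J_add_le (hΩ : IsOpen Ω) {y u p v z : L2 Ω}
    (h : P.SolvesOptimalitySystem y u p) (hv : v ∈ P.Uad) (hz : P.IsState v z) :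
    P.J y u + 1 / 2 * ‖z - y‖ ^ 2 + P.lam / 2 * ‖v - u‖ ^ 2 ≤ P.J z v := by
  obtain ⟨hy, hp, -, hu⟩ := h
  have hzy : P.IsWeakSolution (v - u) (z - y) := by
    have := IsWeakSolution.sub hΩ (P := P) hz hy
    rwa [add_sub_add_left_eq_sub] at this
  have h1 : inner ℝ (v - u) p = inner ℝ (y - P.yd) (z - y) :=
    hzy.inner_comm (h := y - P.yd) hp
  have h2 := hu v hv
  rw [inner_add_left, inner_smul_left, conj_trivial, real_inner_comm, h1] at h2
  have e1 := norm_add_sq_real (y - P.yd) (z - y)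
  have e2 := norm_add_sq_real (u - P.ud) (v - u)
  rw [show y - P.yd + (z - y) = z - P.yd by abel] at e1
  rw [show u - P.ud + (v - u) = v - P.ud by abel] at e2
  rw [J, J, e1, e2]
  nlinarith

theorem SolvesOptimalitySystem.isOptimal (hΩ : IsOpen Ω) {y u p : L2 Ω}
    (h : P.SolvesOptimalitySystem y u p) : P.IsOptimal y u :=
  ⟨h.2.2.1, h.1, fun v hv z hz => by
    have h1 := h.J_add_le hΩ hv hz
    have := P.lam_pos
    have : 0 ≤ 1 / 2 * ‖z - y‖ ^ 2 + P.lam / 2 * ‖v - u‖ ^ 2 := by positivity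
    linarith⟩

theorem SolvesOptimalitySystem.eq_of_isOptimal (hΩ : IsOpen Ω) {y u p v z : L2 Ω}
    (h : P.SolvesOptimalitySystem y u p) (hv : P.IsOptimal z v) : z = y ∧ v = u := by
  have h1 := h.J_add_le hΩ hv.1 hv.2.1
  have h2 := hv.2.2 u h.2.2.1 y h.1
  have h3 : 0 ≤ P.lam / 2 * ‖v - u‖ ^ 2 := by
    have := P.lam_pos
    positivity
  have h4 : 0 ≤ 1 / 2 * ‖z - y‖ ^ 2 := by positivity
  have h5 : 1 / 2 * ‖z - y‖ ^ 2 = 0 := by linarith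
  have h6 : P.lam / 2 * ‖v - u‖ ^ 2 = 0 := by linarith
  have hl : P.lam / 2 ≠ 0 := by
    have := P.lam_pos
    positivity
  simp only [mul_eq_zero, hl, false_or, ne_eq, OfNat.ofNat_ne_zero, not_false_eq_true,
    pow_eq_zero_iff, norm_eq_zero, sub_eq_zero] at h5 h6
  exact ⟨h5.resolve_left (by norm_num), h6⟩

theorem SolvesOptimalitySystem.unique (hΩ : IsOpen Ω) {C : ℝ} (hC : IsFriedrichsConstant Ω C)
    {y u p y' u' p' : L2 Ω} (h : P.SolvesOptimalitySystem y u p)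
    (h' : P.SolvesOptimalitySystem y' u' p') : y' = y ∧ u' = u ∧ p' = p := by
  obtain ⟨rfl, rfl⟩ := h.eq_of_isOptimal hΩ (h'.isOptimal hΩ)
  exact ⟨rfl, rfl, IsWeakSolution.unique hΩ hC (P := P) h'.2.1 h.2.1⟩

variable (P)

/-- Necessity needs no differentiation: the system has a solution, and quadratic growth forces any
optimal pair to coincide with it. -/
theorem isOptimal_iff (hΩ : IsOpen Ω) {C : ℝ} (hC : IsFriedrichsConstant Ω C) (y u : L2 Ω) :
    P.IsOptimal y u ↔ ∃ p, P.SolvesOptimalitySystem y u p := by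
  refine ⟨fun h => ?_, fun ⟨p, hp⟩ => hp.isOptimal hΩ⟩
  obtain ⟨y', u', p, hp⟩ := P.exists_solvesOptimalitySystem hΩ hC
  obtain ⟨rfl, rfl⟩ := hp.eq_of_isOptimal hΩ h
  exact ⟨p, hp⟩

/-! ### Two-sided bounds on the cost and the error majorant -/

theorem add_sq_le_young {α : ℝ} (hα : 0 < α) (x y : ℝ) :
    (x + y) ^ 2 ≤ (1 + α) * x ^ 2 + (1 + α) / α * y ^ 2 := by
  have h : (1 + α) * x ^ 2 + (1 + α) / α * y ^ 2 - (x + y) ^ 2 = (α * x - y) ^ 2 / α := by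
    field_simp
    ring
  have : 0 ≤ (α * x - y) ^ 2 / α := by positivity
  linarith

variable {P}

/-- Young's inequality with `α` splits `y - yd` into `η - yd` and the error `y - η`; Young's with
`β` splits the residual bound for that error. -/
theorem J_le_costMajorant (hΩ : IsOpen Ω) {C : ℝ} (hC : IsFriedrichsConstant Ω C)
    {α β : ℝ} (hα : 0 < α) (hβ : 0 < β) {v y η : L2 Ω} {τ : L2Vec Ω} (hy : P.IsState v y)
    (hη : η ∈ H10 Ω) (hτ : τ ∈ Hdiv Ω) : P.J y v ≤ P.costMajorant C α β η τ v := by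
  have hν := P.νlow_pos
  have hC0 := hC.1
  have h1 := IsWeakSolution.norm_grad_sub_le (P := P) hΩ hC hy hη hτ
  have h2 := hC.2 _ (sub_mem_H10 hΩ hy.1 hη)
  set a := ‖P.f + v + divergence τ‖
  set b := ‖τ - P.flux η‖
  have h3 : ‖y - η‖ ≤ C / P.νlow * (b + C * a) := by
    calc ‖y - η‖ ≤ C * ‖grad (y - η)‖ := h2
      _ ≤ C * (1 / P.νlow * (C * a + b)) := mul_le_mul_of_nonneg_left h1 hC0.le
      _ = _ := by ring
  have h4 : ‖y - η‖ ^ 2 ≤ (C / P.νlow) ^ 2 * ((1 + β) * b ^ 2 + (1 + β) / β * (C * a) ^ 2) := by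
    calc ‖y - η‖ ^ 2 ≤ (C / P.νlow * (b + C * a)) ^ 2 := pow_le_pow_left₀ (norm_nonneg _) h3 2
      _ = (C / P.νlow) ^ 2 * (b + C * a) ^ 2 := mul_pow _ _ _
      _ ≤ _ := mul_le_mul_of_nonneg_left (add_sq_le_young hβ _ _) (sq_nonneg _)
  have h5 : ‖y - P.yd‖ ^ 2 ≤ (1 + α) * ‖η - P.yd‖ ^ 2 + (1 + α) / α * ‖y - η‖ ^ 2 := by
    refine le_trans (pow_le_pow_left₀ (norm_nonneg _) ?_ 2) (add_sq_le_young hα _ _)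
    rw [show y - P.yd = (η - P.yd) + (y - η) by abel]
    exact norm_add_le _ _
  have h6 : (1 + α) / α * ‖y - η‖ ^ 2 ≤ (1 + α) / α *
      ((C / P.νlow) ^ 2 * ((1 + β) * b ^ 2 + (1 + β) / β * (C * a) ^ 2)) :=
    mul_le_mul_of_nonneg_left h4 (by positivity)
  have h7 : P.costMajorant C α β η τ v = 1 / 2 * ((1 + α) * ‖η - P.yd‖ ^ 2 + (1 + α) / α *
      ((C / P.νlow) ^ 2 * ((1 + β) * b ^ 2 + (1 + β) / β * (C * a) ^ 2)))
      + P.lam / 2 * ‖v - P.ud‖ ^ 2 := by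
    rw [costMajorant]
    field_simp
    ring
  rw [h7, J]
  linarith

/-- The square `‖y - yd‖²` is expanded about `η` and `‖y - η‖²` dropped. The cross term `(η - yd, y
- η)` is rewritten through `ζ`, leaving the computable terms and adjoint residuals paired with the
error. -/
theorem costMinorant_le_J (hΩ : IsOpen Ω) {C : ℝ} (hC : IsFriedrichsConstant Ω C)
    {v y η ζ : L2 Ω} {τ ρ : L2Vec Ω} (hy : P.IsState v y) (hη : η ∈ H10 Ω) (hζ : ζ ∈ H10 Ω)
    (hτ : τ ∈ Hdiv Ω) (hρ : ρ ∈ Hdiv Ω) : P.costMinorant C η ζ τ ρ v ≤ P.J y v := by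
  have hν := P.νlow_pos
  have hl := P.lam_pos
  have hC0 := hC.1
  have he := sub_mem_H10 hΩ hy.1 hη
  have h1 := IsWeakSolution.norm_grad_sub_le (P := P) hΩ hC hy hη hτ
  have h2 := IsWeakSolution.inner_flux_sub (P := P) hΩ hy hη hτ hζ
  have h3 : inner ℝ (P.flux (y - η)) (grad ζ) = inner ℝ (P.flux ζ) (grad (y - η)) :=
    P.inner_coeffMul_comm _ _
  have h4 := inner_divergence hΩ hρ he
  have h5 : inner ℝ (P.flux ζ) (grad (y - η)) - inner ℝ (η - P.yd) (y - η)
      = -(inner ℝ (η - P.yd + divergence ρ) (y - η) + inner ℝ (ρ - P.flux ζ) (grad (y - η))) := by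
    rw [inner_add_left, inner_sub_left ρ, h4]
    ring
  have h6 : -(inner ℝ (η - P.yd + divergence ρ) (y - η))
      ≤ ‖η - P.yd + divergence ρ‖ * (C * ‖grad (y - η)‖) :=
    ((neg_le_abs _).trans (abs_real_inner_le_norm _ _)).trans
      (mul_le_mul_of_nonneg_left (hC.2 _ he) (norm_nonneg _))
  have h7 : -(inner ℝ (ρ - P.flux ζ) (grad (y - η))) ≤ ‖ρ - P.flux ζ‖ * ‖grad (y - η)‖ :=
    (neg_le_abs _).trans (abs_real_inner_le_norm _ _)
  have h8 := norm_add_sq_real (η - P.yd) (y - η)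
  rw [show η - P.yd + (y - η) = y - P.yd by abel] at h8
  rw [costMinorant, J, h8]
  set a := ‖P.f + v + divergence τ‖
  set b := ‖τ - P.flux η‖
  set r := ‖η - P.yd + divergence ρ‖
  set s := ‖ρ - P.flux ζ‖
  set n := ‖grad (y - η)‖
  have h9 : (C * r + s) * n ≤ 1 / P.νlow * (C * r + s)
      * (C ^ 3 / (P.lam * P.νlow) * r + C ^ 2 / (P.lam * P.νlow) * s + C * a + b) := by
    have ha : 0 ≤ a := norm_nonneg _
    have hb : 0 ≤ b := norm_nonneg _
    have hr : 0 ≤ r := norm_nonneg _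
    have hs : 0 ≤ s := norm_nonneg _
    calc (C * r + s) * n ≤ (C * r + s) * (1 / P.νlow * (C * a + b)) :=
          mul_le_mul_of_nonneg_left h1 (by positivity)
      _ = 1 / P.νlow * (C * r + s) * (C * a + b) := by ring
      _ ≤ _ := by
        refine mul_le_mul_of_nonneg_left ?_ (by positivity)
        -- The terms with `1 / lam` are only slack here: for the cost at the same control `v` the
        -- bound holds without them.
        have : 0 ≤ C ^ 3 / (P.lam * P.νlow) * r + C ^ 2 / (P.lam * P.νlow) * s := by positivity
        linarith
  nlinarith [sq_nonneg ‖y - η‖]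

theorem errorMajorant_nonneg (hΩ : IsOpen Ω) {C : ℝ} (hC : IsFriedrichsConstant Ω C)
    {α β : ℝ} (hα : 0 < α) (hβ : 0 < β) {v η ζ : L2 Ω} {τ ρ : L2Vec Ω} (hη : η ∈ H10 Ω)
    (hζ : ζ ∈ H10 Ω) (hτ : τ ∈ Hdiv Ω) (hρ : ρ ∈ Hdiv Ω) :
    0 ≤ P.errorMajorant C α β η ζ τ ρ v := by
  obtain ⟨S, hS⟩ := P.exists_solutionOperator hΩ hC
  have hy : P.IsState v (S (P.f + v)) := hS _
  exact sub_nonneg.2 ((costMinorant_le_J hΩ hC hy hη hζ hτ hρ).trans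
    (J_le_costMajorant hΩ hC hα hβ hy hη hτ))

/-- Exact fluxes satisfy `div (ν∇y) = -(f + u)` and `div (ν∇p) = -(y - yd)`, so every residual is
zero and only the difference of the coefficients `(1 + α) / 2` and `1 / 2` survives. -/
theorem SolvesOptimalitySystem.errorMajorant_eq (hΩ : IsOpen Ω) {y u p : L2 Ω}
    (h : P.SolvesOptimalitySystem y u p) (C α β : ℝ) :
    P.errorMajorant C α β y p (P.flux y) (P.flux p) u = α / 2 * ‖y - P.yd‖ ^ 2 := by
  have h1 : divergence (P.flux y) = -(P.f + u) :=
    IsWeakSolution.divergence_flux (P := P) hΩ h.1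
  have h2 : divergence (P.flux p) = -(y - P.yd) :=
    IsWeakSolution.divergence_flux (P := P) hΩ h.2.1
  rw [errorMajorant, costMajorant, costMinorant, h1, h2, add_neg_cancel, add_neg_cancel,
    sub_self, sub_self, inner_zero_left, inner_zero_left, norm_zero, norm_zero]
  ring

end Problem

end EllipticOCP

end

/-! ### The limit `α → 0` and the main theorem -/

theorem tendsto_half_mul_nhdsGT_zero (c : ℝ) :
    Tendsto (fun α : ℝ => α / 2 * c) (𝓝[>] 0) (𝓝 0) := by
  have h : Tendsto (fun α : ℝ => α / 2 * c) (𝓝 0) (𝓝 (0 / 2 * c)) :=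
    (Continuous.tendsto (by fun_prop) 0)
  rw [zero_div, zero_mul] at h
  exact h.mono_left nhdsWithin_le_nhds

theorem mainTheorem7 {d : ℕ} (hd : 0 < d) {Ω : Set (EllipticOCP.Space d)}
    (hΩ : IsOpen Ω) (hΩb : Bornology.IsBounded Ω) (P : EllipticOCP.Problem Ω) :
    -- a Friedrichs constant exists
    (∃ C : ℝ, EllipticOCP.IsFriedrichsConstant Ω C) ∧
    -- the exact solution exists, is unique, and the two descriptions of it are equivalent
    (∃! s : EllipticOCP.L2 Ω × EllipticOCP.L2 Ω × EllipticOCP.L2 Ω,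
      P.SolvesOptimalitySystem s.1 s.2.1 s.2.2) ∧
    (∀ y u : EllipticOCP.L2 Ω, P.IsOptimal y u ↔ ∃ p, P.SolvesOptimalitySystem y u p) ∧
    ∀ C : ℝ, EllipticOCP.IsFriedrichsConstant Ω C →
      -- the infimum of the error majorant is zero
      IsGLB {m : ℝ | ∃ (α β : ℝ) (η ζ : EllipticOCP.L2 Ω) (τ ρ : EllipticOCP.L2Vec Ω),
          0 < α ∧ 0 < β ∧ η ∈ EllipticOCP.H10 Ω ∧ ζ ∈ EllipticOCP.H10 Ω ∧
          τ ∈ EllipticOCP.Hdiv Ω ∧ ρ ∈ EllipticOCP.Hdiv Ω ∧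
          m = P.errorMajorant C α β η ζ τ ρ (P.control ζ)} 0 ∧
      -- it is approached at the exact solution as `α → 0`
      ∀ y u p : EllipticOCP.L2 Ω, P.SolvesOptimalitySystem y u p →
        P.control p = u ∧ P.flux y ∈ EllipticOCP.Hdiv Ω ∧ P.flux p ∈ EllipticOCP.Hdiv Ω ∧
        (∀ α β : ℝ, 0 < α → 0 < β →
          P.errorMajorant C α β y p (P.flux y) (P.flux p) u = α / 2 * ‖y - P.yd‖ ^ 2) ∧
        ∀ β : ℝ, 0 < β →
          Tendsto (fun α : ℝ => P.errorMajorant C α β y p (P.flux y) (P.flux p) u)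
            (𝓝[>] 0) (𝓝 0) := by
  obtain ⟨C₀, hC₀⟩ := EllipticOCP.exists_isFriedrichsConstant hd hΩ hΩb
  obtain ⟨y₀, u₀, p₀, h₀⟩ := P.exists_solvesOptimalitySystem hΩ hC₀
  have exact_solution : ∀ y u p : EllipticOCP.L2 Ω, P.SolvesOptimalitySystem y u p →
      P.control p = u ∧ P.flux y ∈ EllipticOCP.Hdiv Ω ∧ P.flux p ∈ EllipticOCP.Hdiv Ω :=
    fun y u p h => ⟨P.eq_control h.2.2.1 h.2.2.2,
      ⟨_, EllipticOCP.Problem.IsWeakSolution.flux_isWeakDivergence (P := P) hΩ h.1⟩,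
      ⟨_, EllipticOCP.Problem.IsWeakSolution.flux_isWeakDivergence (P := P) hΩ h.2.1⟩⟩
  refine ⟨⟨C₀, hC₀⟩, ⟨(y₀, u₀, p₀), h₀, ?_⟩, P.isOptimal_iff hΩ hC₀, fun C hC => ⟨⟨?_, ?_⟩, ?_⟩⟩
  · rintro ⟨y, u, p⟩ h
    obtain ⟨rfl, rfl, rfl⟩ := h₀.unique hΩ hC₀ h
    rfl
  · rintro _ ⟨α, β, η, ζ, τ, ρ, hα, hβ, hη, hζ, hτ, hρ, rfl⟩
    exact EllipticOCP.Problem.errorMajorant_nonneg hΩ hC hα hβ hη hζ hτ hρ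
  · intro b hb
    obtain ⟨hu, hτ, hρ⟩ := exact_solution _ _ _ h₀
    -- A lower bound `b` lies below `α / 2 ‖y₀ - yd‖²` for every `α > 0`, hence below the limit `0`;
    -- `β = 1` is an arbitrary choice.
    refine ge_of_tendsto (tendsto_half_mul_nhdsGT_zero (‖y₀ - P.yd‖ ^ 2)) ?_
    filter_upwards [self_mem_nhdsWithin] with α hα
    refine hb ⟨α, 1, y₀, p₀, P.flux y₀, P.flux p₀, hα, one_pos, h₀.1.1, h₀.2.1.1, hτ, hρ, ?_⟩
    rw [hu, h₀.errorMajorant_eq hΩ]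
  · intro y u p h
    obtain ⟨hu, hτ, hρ⟩ := exact_solution _ _ _ h
    refine ⟨hu, hτ, hρ, fun α β _ _ => h.errorMajorant_eq hΩ C α β, fun β _ => ?_⟩
    simp_rw [h.errorMajorant_eq hΩ]
    exact tendsto_half_mul_nhdsGT_zero _
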